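/- A Dyck path of length $2n$ is a lattice path from $(0,0)$ to $(2n,0)$ with steps $(x,y)\to(x+1,y+1)$ and $(x,y)\to(x+1,y-1)$ that never goes strictly below the $x$-axis; let $\mathrm{Dyck}(n)$ be the (finite) set of these paths. For $P\in\mathrm{Dyck}(n)$ let $\mathrm{Area}(P)$ be the area of the region between $P$ and the $x$-axis. Let $C_n=\frac{(2n)!}{n!\,(n+1)!}$ be the $n$-th Catalan number. **Fact 1.** For every integer $r\ge 0$ there exist polynomials $P_1,P_2\in\mathbb{Q}[x]$ (depending on $r$) such that for all integers $n\ge 0$ $$\sum_{P\in \mathrm{Dyck}(n)}\mathrm{Area}(P)^r \;=\; P_1(n)\,C_n+P_2(n)\,4^n ,$$ with the convention $0^0=1$. -/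

import Mathlib

/-- The height (ordinate) of a Dyck path above the abscissa `i`, i.e. the number of up steps minus
the number of down steps among its first `i` steps. -/
def DyckWord.height (p : DyckWord) (i : ℕ) : ℤ :=
  ((p.toList.take i).count DyckStep.U : ℤ) - ((p.toList.take i).count DyckStep.D : ℤ)

/-- The area of the region between a Dyck path and the `x`-axis: the sum, over the unit steps from
abscissa `i` to abscissa `i + 1`, of the areas of the trapezoids below them. -/
def DyckWord.area (p : DyckWord) : ℚ :=
  ∑ i ∈ Finset.range p.toList.length, ((p.height i : ℚ) + (p.height (i + 1) : ℚ)) / 2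

/-! ### Area under concatenation and nesting; first-return decomposition. -/

namespace DyckWord

/-! Write `C` and `B` for the generating functions of the Catalan numbers and central binomial
coefficients, `A_r` for that of the `r`-th area moments, `N_r` for its nested analogue, and `E = X
d/dX`. By first return, `A_r` is `X` times a binomial convolution of the `N_m` and `A_(r-m)`. Since
nesting adds `2n+1` to the area, `N_r` is `A_r` plus images of lower moments under powers of `2E+1`.
Isolating `A_r` leaves the factor `1 - 2XC`, whose inverse is `B`. By induction, `A_r` lies in the
span of `C` and the positive powers of `B`, which is stable under `E` (`eulerOp_mem`) and under `f,
g ↦ X B f g` (`X_mul_centralBinomGF_mul_mem`). Odd powers of `B` have coefficients polynomial times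
`C_n`, even ones polynomial times `4^n`. -/

lemma height_add_of_le (p q : DyckWord) {i : ℕ} (hi : i ≤ p.toList.length) :
    (p + q).height i = p.height i := by
  have h : (p + q).toList = p.toList ++ q.toList := rfl
  simp only [height, h, List.take_append_of_le_length hi]

lemma height_length (p : DyckWord) : p.height p.toList.length = 0 := by
  simp [height, p.count_U_eq_count_D]

lemma height_add_length_add (p q : DyckWord) (i : ℕ) :
    (p + q).height (p.toList.length + i) = q.height i := by
  have h : (p + q).toList = p.toList ++ q.toList := rfl
  simp only [height, h, List.take_length_add_append, List.count_append, p.count_U_eq_count_D]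
  push_cast
  ring

lemma area_add (p q : DyckWord) : (p + q).area = p.area + q.area := by
  have h : (p + q).toList.length = p.toList.length + q.toList.length := List.length_append
  rw [area, h, Finset.sum_range_add]
  congr 1
  · refine Finset.sum_congr rfl fun i hi => ?_
    rw [Finset.mem_range] at hi
    rw [height_add_of_le p q hi.le, height_add_of_le p q hi]
  · refine Finset.sum_congr rfl fun i _ => ?_
    rw [add_assoc, height_add_length_add, height_add_length_add]

lemma height_nest_succ (p : DyckWord) {i : ℕ} (hi : i ≤ p.toList.length) :
    p.nest.height (i + 1) = p.height i + 1 := by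
  have h : p.nest.toList = DyckStep.U :: (p.toList ++ [DyckStep.D]) := rfl
  simp only [height, h, List.take_succ_cons, List.take_append_of_le_length hi]
  simp
  ring

/-- The path is lifted by one, adding a unit square per step; the two new steps add two triangles of
area 1/2. -/
lemma area_nest (p : DyckWord) : p.nest.area = p.area + (2 * p.semilength + 1) := by
  have h : p.nest.toList.length = p.toList.length + 1 + 1 := by simp [nest]
  have h0 : p.nest.height 0 = 0 := by simp [height]
  have h1 : p.nest.height (p.toList.length + 1 + 1) = 0 := by rw [← h, height_length]
  have hl : (2 * p.semilength : ℚ) = p.toList.length := by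
    exact_mod_cast p.two_mul_semilength_eq_length
  rw [area, h, Finset.sum_range_succ, Finset.sum_range_succ', h0, h1, zero_add,
    height_nest_succ p le_rfl, height_length, height_nest_succ p (Nat.zero_le _)]
  have hs : ∀ i ∈ Finset.range p.toList.length,
      ((p.nest.height (i + 1) : ℚ) + (p.nest.height (i + 1 + 1) : ℚ)) / 2 =
        ((p.height i : ℚ) + (p.height (i + 1) : ℚ)) / 2 + 1 := by
    intro i hi
    rw [Finset.mem_range] at hi
    rw [height_nest_succ p hi.le, height_nest_succ p hi]
    push_cast
    ring
  rw [Finset.sum_congr rfl hs, Finset.sum_add_distrib, ← area, hl]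
  have : p.height 0 = 0 := by simp [height]
  simp [this]
  ring

/-- The first-return decomposition of Dyck words of given positive semilength. -/
def firstReturnEquiv (n : ℕ) : {p : DyckWord // p.semilength = n + 1} ≃
    (Σ ij : Finset.HasAntidiagonal.antidiagonal n,
      {p : DyckWord // p.semilength = ij.1.1} × {p : DyckWord // p.semilength = ij.1.2}) where
  toFun p := ⟨⟨(p.1.insidePart.semilength, p.1.outsidePart.semilength), by
      have h0 : p.1 ≠ 0 := by
        intro h
        have := p.2
        simp [h] at this
      have h := semilength_insidePart_add_semilength_outsidePart_add_one h0
      have := p.2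
      rw [Finset.HasAntidiagonal.mem_antidiagonal]
      lia⟩, ⟨p.1.insidePart, rfl⟩, ⟨p.1.outsidePart, rfl⟩⟩
  invFun x := ⟨x.2.1.1.nest + x.2.2.1, by
    have h := Finset.HasAntidiagonal.mem_antidiagonal.mp x.1.2
    rw [semilength_add, semilength_nest, x.2.1.2, x.2.2.2]
    lia⟩
  left_inv p := by
    have h0 : p.1 ≠ 0 := by
      intro h
      have := p.2
      simp [h] at this
    exact Subtype.ext (nest_insidePart_add_outsidePart h0)
  right_inv := by
    rintro ⟨⟨⟨i, j⟩, h⟩, ⟨p, hp⟩, ⟨q, hq⟩⟩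
    dsimp only at hp hq
    subst hp hq
    have h1 : (p.nest + q).insidePart = p := by
      rw [insidePart_add nest_ne_zero, insidePart_nest]
    have h2 : (p.nest + q).outsidePart = q := by
      rw [outsidePart_add nest_ne_zero, outsidePart_nest, zero_add]
    -- The sigma type depends on the semilengths, so `a` and `b` are generalized to be substituted
    -- away.
    have key : ∀ (a b : DyckWord) (_ : a = p) (_ : b = q)
        (hab : (a.semilength, b.semilength) ∈ Finset.HasAntidiagonal.antidiagonal n),
        (⟨⟨(a.semilength, b.semilength), hab⟩, ⟨a, rfl⟩, ⟨b, rfl⟩⟩ :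
          Σ ij : Finset.HasAntidiagonal.antidiagonal n,
            {p : DyckWord // p.semilength = ij.1.1} × {p : DyckWord // p.semilength = ij.1.2}) =
          ⟨⟨(p.semilength, q.semilength), h⟩, ⟨p, rfl⟩, ⟨q, rfl⟩⟩ := by
      rintro a b rfl rfl _
      rfl
    exact key _ _ h1 h2 _

lemma sum_semilength_succ {M : Type*} [AddCommMonoid M] (n : ℕ) (f : DyckWord → M) :
    ∑ p : {p : DyckWord // p.semilength = n + 1}, f p.1 =
      ∑ ij ∈ Finset.HasAntidiagonal.antidiagonal n, ∑ p : {p : DyckWord // p.semilength = ij.1},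
        ∑ q : {p : DyckWord // p.semilength = ij.2}, f (p.1.nest + q.1) := by
  rw [← (firstReturnEquiv n).symm.sum_comp, Fintype.sum_sigma]
  rw [← Finset.sum_coe_sort (Finset.HasAntidiagonal.antidiagonal n)]
  refine Finset.sum_congr rfl fun ij _ => ?_
  rw [Fintype.sum_prod_type]
  rfl

end DyckWord

/-! ### Algebraic and differential relations between `C` and `B`. -/

namespace PowerSeries

/-- The Catalan generating function over `ℚ`. -/
noncomputable def catalanGF : ℚ⟦X⟧ := mk fun n => (catalan n : ℚ)

/-- The generating function of the central binomial coefficients over `ℚ`. -/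
noncomputable def centralBinomGF : ℚ⟦X⟧ := mk fun n => (n.centralBinom : ℚ)

/-- The Euler operator `X * d/dX`. -/
noncomputable def eulerOp : ℚ⟦X⟧ →ₗ[ℚ] ℚ⟦X⟧ :=
  LinearMap.mulLeft ℚ X ∘ₗ (derivative ℚ).toLinearMap

lemma eulerOp_apply (f : ℚ⟦X⟧) : eulerOp f = X * derivative ℚ f := rfl

lemma coeff_eulerOp (f : ℚ⟦X⟧) (n : ℕ) : coeff n (eulerOp f) = n * coeff n f := by
  rw [eulerOp_apply]
  cases n with
  | zero => simp
  | succ n => rw [coeff_succ_X_mul, coeff_derivative]; push_cast; ring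

lemma catalanGF_eq : catalanGF = 1 + X * catalanGF ^ 2 := by
  ext n
  cases n with
  | zero => simp [catalanGF]
  | succ n =>
    rw [map_add, coeff_succ_X_mul]
    simp [catalanGF, coeff_one, sq, coeff_mul, catalan_succ']

lemma derivative_X_mul_catalanGF : derivative ℚ (X * catalanGF) = centralBinomGF := by
  ext n
  rw [coeff_derivative, coeff_succ_X_mul]
  simp only [catalanGF, centralBinomGF, coeff_mk]
  rw [← succ_mul_catalan_eq_centralBinom]
  push_cast
  ring

/-- Differentiate `(1 - 2XC)^2 = 1 - 4X`, using `(XC)' = B`, and cancel 4. -/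
lemma one_sub_mul_centralBinomGF : (1 - 2 * X * catalanGF) * centralBinomGF = 1 := by
  have hs : (1 - 2 * (X * catalanGF)) ^ 2 = 1 - 4 * X := by
    linear_combination (-4 * X) * catalanGF_eq
  have h := congrArg (derivative ℚ) hs
  have h2 : derivative ℚ (2 : ℚ⟦X⟧) = 0 := derivative_C (r := (2 : ℚ))
  have h4 : derivative ℚ (4 : ℚ⟦X⟧) = 0 := derivative_C (r := (4 : ℚ))
  rw [derivative_pow, map_sub, map_sub, Derivation.leibniz, Derivation.leibniz (derivative ℚ) 4,
    derivative_X_mul_catalanGF, h2, h4] at h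
  simp only [smul_eq_mul, derivative_X, Derivation.map_one_eq_zero] at h
  norm_num at h
  have : CharZero ℚ⟦X⟧ := algebraRat.charZero _
  apply mul_left_cancel₀ (by norm_num : (4 : ℚ⟦X⟧) ≠ 0)
  linear_combination h

lemma centralBinomGF_sq : centralBinomGF ^ 2 * (1 - 4 * X) = 1 := by
  linear_combination (4 * X * centralBinomGF ^ 2) * catalanGF_eq +
    ((1 - 2 * X * catalanGF) * centralBinomGF + 1) * one_sub_mul_centralBinomGF

lemma centralBinomGF_mul_catalanGF :
    centralBinomGF * catalanGF = 2 * centralBinomGF - catalanGF := by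
  linear_combination (2 * centralBinomGF) * catalanGF_eq - catalanGF * one_sub_mul_centralBinomGF

lemma coeff_centralBinomGF_sq (n : ℕ) : coeff n (centralBinomGF ^ 2) = 4 ^ n := by
  have h : (mk fun n => (4 : ℚ) ^ n) * (1 - 4 * X) = 1 := by
    ext n
    rw [mul_sub, mul_one, ← mul_assoc, map_sub]
    have : (4 : ℚ⟦X⟧) = C (4 : ℚ) := rfl
    cases n with
    | zero => simp
    | succ n =>
      rw [coeff_succ_mul_X, this, coeff_mul_C]
      simp [coeff_one]
      ring
  have h' : centralBinomGF ^ 2 = mk fun n => (4 : ℚ) ^ n := by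
    linear_combination (mk fun n => (4 : ℚ) ^ n) * centralBinomGF_sq - centralBinomGF ^ 2 * h
  rw [h', coeff_mk]

lemma two_mul_eulerOp_centralBinomGF :
    2 * eulerOp centralBinomGF = centralBinomGF ^ 3 - centralBinomGF := by
  have h := congrArg (derivative ℚ) centralBinomGF_sq
  have h4 : derivative ℚ (4 : ℚ⟦X⟧) = 0 := derivative_C (r := (4 : ℚ))
  rw [Derivation.leibniz, derivative_pow, map_sub, Derivation.leibniz (derivative ℚ) 4, h4] at h
  simp only [smul_eq_mul, derivative_X, Derivation.map_one_eq_zero] at h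
  norm_num at h
  rw [eulerOp_apply]
  linear_combination X * centralBinomGF * h -
    (2 * X * derivative ℚ centralBinomGF + centralBinomGF) * centralBinomGF_sq

lemma eulerOp_catalanGF : eulerOp catalanGF = centralBinomGF - catalanGF := by
  have h := derivative_X_mul_catalanGF
  rw [Derivation.leibniz, derivative_X, smul_eq_mul, smul_eq_mul] at h
  rw [eulerOp_apply]
  linear_combination h

lemma eulerOp_centralBinomGF_pow (k : ℕ) :
    eulerOp (centralBinomGF ^ (k + 1)) =
      ((k + 1 : ℚ) / 2) • (centralBinomGF ^ (k + 3) - centralBinomGF ^ (k + 1)) := by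
  have : CharZero ℚ⟦X⟧ := algebraRat.charZero _
  have hc : ((k + 1 : ℚ) / 2) • (centralBinomGF ^ (k + 3) - centralBinomGF ^ (k + 1)) * 2 =
      (k + 1) * (centralBinomGF ^ (k + 3) - centralBinomGF ^ (k + 1)) := by
    have : (2 : ℚ⟦X⟧) = C (2 : ℚ) := rfl
    rw [smul_eq_C_mul, mul_right_comm, this, ← map_mul]
    simp
  apply mul_right_cancel₀ (two_ne_zero (α := ℚ⟦X⟧))
  have h := two_mul_eulerOp_centralBinomGF
  rw [eulerOp_apply] at h
  rw [hc, eulerOp_apply, derivative_pow]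
  simp only [Nat.add_sub_cancel]
  push_cast
  linear_combination (k + 1) * centralBinomGF ^ k * h

/-! ### The span of `C` and the positive powers of `B`, and its closure properties. -/

/-- The span of the Catalan generating function and the positive powers of the generating function
of the central binomial coefficients. -/
noncomputable def catalanSpan : Submodule ℚ ℚ⟦X⟧ :=
  Submodule.span ℚ (insert catalanGF (Set.range fun k : ℕ => centralBinomGF ^ (k + 1)))

lemma catalanGF_mem : catalanGF ∈ catalanSpan :=
  Submodule.subset_span (Set.mem_insert _ _)

lemma centralBinomGF_pow_mem (k : ℕ) : centralBinomGF ^ (k + 1) ∈ catalanSpan :=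
  Submodule.subset_span (Set.mem_insert_of_mem _ ⟨k, rfl⟩)

lemma centralBinomGF_mem : centralBinomGF ∈ catalanSpan := by
  simpa using centralBinomGF_pow_mem 0

lemma catalanSpan_le {N : Submodule ℚ ℚ⟦X⟧} (hC : catalanGF ∈ N)
    (ht : ∀ k : ℕ, centralBinomGF ^ (k + 1) ∈ N) : catalanSpan ≤ N := by
  rw [catalanSpan, Submodule.span_le, Set.insert_subset_iff, Set.range_subset_iff]
  exact ⟨hC, ht⟩

lemma eulerOp_mem {f : ℚ⟦X⟧} (hf : f ∈ catalanSpan) : eulerOp f ∈ catalanSpan := by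
  refine catalanSpan_le (N := catalanSpan.comap eulerOp) ?_ (fun k => ?_) hf
  · rw [Submodule.mem_comap, eulerOp_catalanGF]
    exact sub_mem centralBinomGF_mem catalanGF_mem
  · rw [Submodule.mem_comap, eulerOp_centralBinomGF_pow]
    exact Submodule.smul_mem _ _ (sub_mem (centralBinomGF_pow_mem (k + 2))
      (centralBinomGF_pow_mem k))

lemma mem_of_mul_nat_mem {m : ℕ} (hm : m ≠ 0) {f : ℚ⟦X⟧} (h : (m : ℚ⟦X⟧) * f ∈ catalanSpan) :
    f ∈ catalanSpan := by
  have hf : f = (m : ℚ)⁻¹ • ((m : ℚ⟦X⟧) * f) := by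
    have : (m : ℚ⟦X⟧) = C (m : ℚ) := by simp
    rw [this, ← smul_eq_C_mul, smul_smul, inv_mul_cancel₀ (by exact_mod_cast hm), one_smul]
  rw [hf]
  exact Submodule.smul_mem _ _ h

/-- `catalanSpan` is closed under the product `f, g ↦ X * centralBinomGF * f * g`. -/
lemma X_mul_centralBinomGF_mul_mem {f g : ℚ⟦X⟧} (hf : f ∈ catalanSpan) (hg : g ∈ catalanSpan) :
    X * centralBinomGF * (f * g) ∈ catalanSpan := by
  have key : ∀ k : ℕ, X * centralBinomGF * (catalanGF * centralBinomGF ^ (k + 1)) ∈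
      catalanSpan := fun k => by
    refine mem_of_mul_nat_mem two_ne_zero ?_
    convert! sub_mem (centralBinomGF_pow_mem (k + 1)) (centralBinomGF_pow_mem k) using 1
    push_cast
    -- This is `2XCB = B - 1`.
    linear_combination -centralBinomGF ^ (k + 1) * one_sub_mul_centralBinomGF
  let L : ℚ⟦X⟧ → ℚ⟦X⟧ →ₗ[ℚ] ℚ⟦X⟧ := fun a =>
    LinearMap.mulLeft ℚ (X * centralBinomGF) ∘ₗ LinearMap.mulLeft ℚ a
  have h1 : ∀ g ∈ catalanSpan, X * centralBinomGF * (catalanGF * g) ∈ catalanSpan := by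
    refine fun g hg => catalanSpan_le (N := catalanSpan.comap (L catalanGF)) ?_ key hg
    change X * centralBinomGF * (catalanGF * catalanGF) ∈ catalanSpan
    -- `X B C^2 = B(C - 1) = B - C`; without the factor `B`, the constant 1 would appear, which is
    -- outside the span.
    convert! sub_mem centralBinomGF_mem catalanGF_mem using 1
    linear_combination -centralBinomGF * catalanGF_eq + centralBinomGF_mul_catalanGF
  have h2 : ∀ k : ℕ, ∀ g ∈ catalanSpan,
      X * centralBinomGF * (centralBinomGF ^ (k + 1) * g) ∈ catalanSpan := by
    refine fun k g hg =>
      catalanSpan_le (N := catalanSpan.comap (L (centralBinomGF ^ (k + 1)))) ?_ (fun j => ?_) hg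
    · have := key k
      rwa [mul_comm catalanGF] at this
    -- Here `4XB^2 = B^2 - 1` is used.
    · refine mem_of_mul_nat_mem four_ne_zero ?_
      convert! sub_mem (centralBinomGF_pow_mem (k + j + 2)) (centralBinomGF_pow_mem (k + j)) using 1
      change ((4 : ℕ) : ℚ⟦X⟧) *
        (X * centralBinomGF * (centralBinomGF ^ (k + 1) * centralBinomGF ^ (j + 1))) = _
      push_cast
      linear_combination -centralBinomGF ^ (k + j + 1) * centralBinomGF_sq
  rw [mul_comm f g]
  refine catalanSpan_le (N := catalanSpan.comap (L g)) ?_ (fun k => ?_) hf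
  · have := h1 g hg
    rwa [mul_comm catalanGF] at this
  · have := h2 k g hg
    rwa [mul_comm (centralBinomGF ^ (k + 1))] at this

/-! ### From the span to coefficients. -/

/-- The power series whose coefficients have the form `P₁(n) Cₙ + P₂(n) 4ⁿ`. -/
noncomputable def catalanPolySpan : Submodule ℚ ℚ⟦X⟧ where
  carrier := {f | ∃ P₁ P₂ : Polynomial ℚ, ∀ n : ℕ,
    coeff n f = P₁.eval (n : ℚ) * (catalan n : ℚ) + P₂.eval (n : ℚ) * (4 : ℚ) ^ n}
  add_mem' := by
    rintro f g ⟨P₁, P₂, hf⟩ ⟨Q₁, Q₂, hg⟩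
    refine ⟨P₁ + Q₁, P₂ + Q₂, fun n => ?_⟩
    rw [map_add, hf, hg, Polynomial.eval_add, Polynomial.eval_add]
    ring
  zero_mem' := ⟨0, 0, by simp⟩
  smul_mem' := by
    rintro c f ⟨P₁, P₂, hf⟩
    refine ⟨Polynomial.C c * P₁, Polynomial.C c * P₂, fun n => ?_⟩
    simp only [map_smul, hf, Polynomial.eval_mul, Polynomial.eval_C, smul_eq_mul]
    ring

lemma eulerOp_mem_catalanPolySpan {f : ℚ⟦X⟧} (hf : f ∈ catalanPolySpan) :
    eulerOp f ∈ catalanPolySpan := by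
  obtain ⟨P₁, P₂, hf⟩ := hf
  refine ⟨Polynomial.X * P₁, Polynomial.X * P₂, fun n => ?_⟩
  rw [coeff_eulerOp, hf, Polynomial.eval_mul, Polynomial.eval_mul, Polynomial.eval_X]
  ring

/-- `E` links `B^(k+3)` to `B^(k+1)`, so induction goes by steps of two, from `B` and `B^2`. -/
lemma centralBinomGF_pow_mem_catalanPolySpan :
    ∀ k : ℕ, centralBinomGF ^ (k + 1) ∈ catalanPolySpan
  | 0 => by
    refine ⟨Polynomial.X + 1, 0, fun n => ?_⟩
    simp only [zero_add, pow_one, centralBinomGF, coeff_mk, ← succ_mul_catalan_eq_centralBinom]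
    simp
  | 1 => ⟨0, 1, fun n => by simpa using coeff_centralBinomGF_sq n⟩
  | k + 2 => by
    have ih := centralBinomGF_pow_mem_catalanPolySpan k
    have h : centralBinomGF ^ (k + 2 + 1) = centralBinomGF ^ (k + 1) +
        (2 / (k + 1 : ℚ)) • eulerOp (centralBinomGF ^ (k + 1)) := by
      have hk : (k + 1 : ℚ) ≠ 0 := by positivity
      rw [eulerOp_centralBinomGF_pow, smul_smul, div_mul_div_cancel₀ hk, div_self two_ne_zero,
        one_smul]
      ring
    rw [h]
    exact add_mem ih (Submodule.smul_mem _ _ (eulerOp_mem_catalanPolySpan ih))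

lemma catalanSpan_le_catalanPolySpan : catalanSpan ≤ catalanPolySpan :=
  catalanSpan_le ⟨1, 0, fun n => by simp [catalanGF]⟩ centralBinomGF_pow_mem_catalanPolySpan

end PowerSeries

/-! ### Recursion for the area moments. -/

namespace DyckWord

open PowerSeries

/-- The generating function of the `r`-th moments of the area of Dyck words. -/
noncomputable def areaMomentGF (r : ℕ) : ℚ⟦X⟧ :=
  PowerSeries.mk fun n => ∑ p : {p : DyckWord // p.semilength = n}, p.1.area ^ r

/-- The generating function of the `r`-th moments of the area of nested Dyck words. -/
noncomputable def nestAreaMomentGF (r : ℕ) : ℚ⟦X⟧ :=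
  PowerSeries.mk fun n => ∑ p : {p : DyckWord // p.semilength = n}, p.1.nest.area ^ r

lemma areaMomentGF_zero : areaMomentGF 0 = catalanGF := by
  ext n
  simp only [areaMomentGF, catalanGF, coeff_mk, pow_zero, Finset.sum_const, nsmul_eq_mul, mul_one,
    Finset.card_univ, card_dyckWord_semilength_eq_catalan]

lemma nestAreaMomentGF_eq (r : ℕ) : nestAreaMomentGF r =
    ∑ m ∈ Finset.range (r + 1),
      (r.choose m : ℚ) • ((2 * eulerOp + 1) ^ (r - m)) (areaMomentGF m) := by
  have hE : ∀ (b : ℕ) (f : ℚ⟦X⟧) (n : ℕ),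
      coeff n (((2 * eulerOp + 1) ^ b) f) = (2 * n + 1) ^ b * coeff n f := by
    intro b f n
    induction b with
    | zero => simp
    | succ b ih =>
      have h2 : ∀ g, (2 * eulerOp + 1) g = (2 : ℚ) • eulerOp g + g := by
        intro g
        simp [two_mul, two_smul]
      rw [pow_succ', Module.End.mul_apply, h2, map_add, map_smul, coeff_eulerOp, ih, smul_eq_mul]
      ring
  ext n
  simp only [nestAreaMomentGF, coeff_mk, map_sum, map_smul, hE, areaMomentGF, smul_eq_mul,
    Finset.mul_sum]
  rw [Finset.sum_comm]
  refine Finset.sum_congr rfl fun p _ => ?_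
  rw [area_nest, p.2, add_pow]
  exact Finset.sum_congr rfl fun m _ => by ring

lemma areaMomentGF_eq {r : ℕ} (hr : r ≠ 0) : areaMomentGF r =
    X * ∑ m ∈ Finset.range (r + 1),
      (r.choose m : ℚ) • (nestAreaMomentGF m * areaMomentGF (r - m)) := by
  ext n
  cases n with
  | zero =>
    -- At `n = 0` the right side vanishes; so does `0^r`, because `r ≠ 0`.
    have hp : ∀ p : {p : DyckWord // p.semilength = 0}, p.1.area = 0 := by
      intro p
      have h := p.1.two_mul_semilength_eq_length
      rw [p.2] at h
      simp [area, ← h]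
    simp [areaMomentGF, hp, hr]
  | succ n =>
    rw [coeff_succ_X_mul]
    simp only [areaMomentGF, nestAreaMomentGF, map_sum, map_smul, coeff_mul, coeff_mk, smul_eq_mul]
    rw [sum_semilength_succ n fun p => p.area ^ r]
    simp only [area_add, add_pow, Finset.mul_sum, Finset.sum_mul]
    symm
    rw [Finset.sum_comm]
    refine Finset.sum_congr rfl fun ij _ => ?_
    rw [Finset.sum_congr rfl fun m _ => Finset.sum_comm, Finset.sum_comm]
    refine Finset.sum_congr rfl fun p _ => ?_
    rw [Finset.sum_comm]
    refine Finset.sum_congr rfl fun q _ => Finset.sum_congr rfl fun m _ => ?_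
    ring

lemma areaMomentGF_mem (r : ℕ) : areaMomentGF r ∈ catalanSpan := by
  induction r using Nat.strong_induction_on with
  | _ r ih =>
    rcases Nat.eq_zero_or_pos r with rfl | hr
    · rw [areaMomentGF_zero]
      exact catalanGF_mem
    have hE : ∀ (b : ℕ) {f : ℚ⟦X⟧}, f ∈ catalanSpan →
        ((2 * eulerOp + 1) ^ b) f ∈ catalanSpan := by
      intro b f hf
      induction b with
      | zero => simpa using hf
      | succ b ihb =>
        rw [pow_succ', Module.End.mul_apply]
        have h2 : ∀ g, (2 * eulerOp + 1) g = eulerOp g + eulerOp g + g := fun g => by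
          simp [two_mul]
        rw [h2]
        exact add_mem (add_mem (eulerOp_mem ihb) (eulerOp_mem ihb)) ihb
    have hN : ∀ m < r, nestAreaMomentGF m ∈ catalanSpan := fun m hm => by
      rw [nestAreaMomentGF_eq]
      refine sum_mem fun a ha => Submodule.smul_mem _ _ (hE _ (ih a ?_))
      rw [Finset.mem_range] at ha
      lia
    -- The top term of `N_r` is `A_r`, so the difference involves only lower moments.
    have hD : nestAreaMomentGF r - areaMomentGF r ∈ catalanSpan := by
      rw [nestAreaMomentGF_eq, Finset.sum_range_succ]
      simp only [Nat.choose_self, Nat.cast_one, one_smul, Nat.sub_self, pow_zero,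
        Module.End.one_apply, add_sub_cancel_right]
      exact sum_mem fun a ha => Submodule.smul_mem _ _ (hE _ (ih a (Finset.mem_range.mp ha)))
    obtain ⟨k, rfl⟩ : ∃ k, r = k + 1 := ⟨r - 1, by lia⟩
    have hr := areaMomentGF_eq hr.ne'
    have h0 : nestAreaMomentGF 0 = catalanGF := by
      simp [nestAreaMomentGF_eq, areaMomentGF_zero]
    rw [Finset.sum_range_succ, Finset.sum_range_succ'] at hr
    simp only [Nat.choose_self, Nat.choose_zero_right, Nat.cast_one, one_smul, Nat.sub_self,
      Nat.sub_zero, h0, areaMomentGF_zero] at hr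
    set S := ∑ m ∈ Finset.range k, ((k + 1).choose (m + 1) : ℚ) •
      (nestAreaMomentGF (m + 1) * areaMomentGF (k + 1 - (m + 1))) with hS
    -- The extreme terms give `X(C A_r + N_r C) = 2XC A_r + X(N_r - A_r)C`; multiplying by `B`
    -- inverts `1 - 2XC`.
    have hsol : areaMomentGF (k + 1) = X * centralBinomGF * S + X * centralBinomGF *
        ((nestAreaMomentGF (k + 1) - areaMomentGF (k + 1)) * catalanGF) := by
      linear_combination centralBinomGF * hr - areaMomentGF (k + 1) * one_sub_mul_centralBinomGF
    rw [hsol]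
    refine add_mem ?_ (X_mul_centralBinomGF_mul_mem hD catalanGF_mem)
    rw [hS, Finset.mul_sum]
    refine sum_mem fun m hm => ?_
    rw [Finset.mem_range] at hm
    rw [mul_smul_comm]
    exact Submodule.smul_mem _ _
      (X_mul_centralBinomGF_mul_mem (hN _ (by lia)) (ih _ (by lia)))

end DyckWord

theorem fact1 (r : ℕ) :
    ∃ P₁ P₂ : Polynomial ℚ, ∀ n : ℕ,
      ∑ p : {p : DyckWord // p.semilength = n}, p.1.area ^ r =
        P₁.eval (n : ℚ) * (catalan n : ℚ) + P₂.eval (n : ℚ) * (4 : ℚ) ^ n := by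
  obtain ⟨P₁, P₂, h⟩ :=
    PowerSeries.catalanSpan_le_catalanPolySpan (DyckWord.areaMomentGF_mem r)
  exact ⟨P₁, P₂, fun n => by rw [← h n, DyckWord.areaMomentGF, PowerSeries.coeff_mk]⟩
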